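/- Let $G$ be an amenable group, let $A$ be an abelian group, and let $\alpha: G \to \mathrm{End}(A)$ be a left action of $G$ on $A$ by group endomorphisms (with $\alpha(1)=\mathrm{id}_A$). Let $N$ be a normal subgroup of $G$, and let $\alpha\restriction_N$ be the restriction of $\alpha$ to $N$. Here a group is amenable if it carries a left invariant and a right invariant finitely additive probability measure defined on all of its subsets. For $S\in\{G,N\}$, let $\beta$ be the corresponding action, that is, $\beta=\alpha$ if $S=G$ and $\beta=\alpha\restriction_N$ if $S=N$. A right Følner net of $S$ is a net $(F_i)_{i\in I}$ of non-empty finite subsets of $S$ such that $\lim_{i\in I} |F_i s\setminus F_i|/|F_i| = 0$ for every $s\in S$. For a non-empty finite subset $X\subseteq A$ put $$H_{alg}(\beta,X)=\lim_{i\in I}\frac{\log\left|\sum_{s\in F_i}\beta(s)(X)\right|}{|F_i|},$$ where $(F_i)_{i\in I}$ is a right Følner net of $S$ and the sum is the Minkowski sum of subsets of $A$. Let $$h_{alg}(\beta)=\sup\{H_{alg}(\beta,X): X\subseteq A \text{ finite, non-empty}\}\in[0,\infty],$$ $$\mathrm{ent}(\beta)=\sup\{H_{alg}(\beta,B): B \text{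 a finite subgroup of } A\}\in[0,\infty].$$ Then these quantities are well defined, i.e. both $G$ and $N$ admit right Følner nets, and for every non-empty finite $X\subseteq A$ the limit defining $H_{alg}(\alpha,X)$, respectively $H_{alg}(\alpha\restriction_N,X)$, exists in $\mathbb{R}$ and does not depend on the chosen right Følner net; moreover, $$h_{alg}(\alpha)\leq h_{alg}(\alpha\restriction_N)\quad\text{and}\quad \mathrm{ent}(\alpha)\leq\mathrm{ent}(\alpha\restriction_N).$$ -/

import Mathlib

open Filter Topology Pointwise

namespace AlgEntropy

/-- A semigroup is left amenable if there is a finitely additive probability measure `μ`, defined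
on all subsets, with `μ (L_s⁻¹ F) = μ F`, where `L_s x = s * x`. -/
def IsLeftAmenable (S : Type*) [Semigroup S] : Prop :=
  ∃ μ : Set S → ℝ,
    (∀ F, 0 ≤ μ F ∧ μ F ≤ 1) ∧
    μ Set.univ = 1 ∧
    (∀ E F, Disjoint E F → μ (E ∪ F) = μ E + μ F) ∧
    ∀ (s : S) (F : Set S), μ ((fun x => s * x) ⁻¹' F) = μ F

/-- A semigroup is right amenable if its opposite is left amenable. -/
def IsRightAmenable (S : Type*) [Semigroup S] : Prop :=
  IsLeftAmenable Sᵐᵒᵖ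

/-- A semigroup is amenable if it is both left and right amenable. -/
def IsAmenable (S : Type*) [Semigroup S] : Prop :=
  IsLeftAmenable S ∧ IsRightAmenable S

open Classical in
/-- The quotient `|F s \ F| / |F|`. -/
noncomputable def rightDefect {S : Type*} [Semigroup S] (s : S) (F : Finset S) : ℝ :=
  ((F.image (fun x => x * s) \ F).card : ℝ) / (F.card : ℝ)

/-- Right Følner nets of a semigroup, indexed by a preorder `I` (in practice nonempty and
directed). -/
def IsRightFolnerNet {S I : Type*} [Semigroup S] [Preorder I] (F : I → Finset S) : Prop :=
  (∀ i, (F i).Nonempty) ∧ ∀ s : S, Tendsto (fun i => rightDefect s (F i)) atTop (𝓝 0)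

/-- The filter of right Følner sets: a net of nonempty finite sets is a right Følner net if and
only if it converges to this filter. So a limit along this filter is the same thing as
a common limit along all right Følner nets. -/
noncomputable def rightFolner (S : Type*) [Semigroup S] : Filter (Finset S) :=
  𝓟 {F | F.Nonempty} ⊓ ⨅ s : S, comap (rightDefect s) (𝓝 0)

theorem isRightFolnerNet_iff {S I : Type*} [Semigroup S] [Preorder I] (F : I → Finset S) :
    IsRightFolnerNet F ↔ (∀ i, (F i).Nonempty) ∧ Tendsto F atTop (rightFolner S) := by
  simp only [IsRightFolnerNet, rightFolner, tendsto_inf, tendsto_iInf, tendsto_comap_iff,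
    tendsto_principal, Set.mem_ofPred_eq, Function.comp_def]
  constructor
  · rintro ⟨h1, h2⟩
    exact ⟨h1, Eventually.of_forall h1, h2⟩
  · rintro ⟨h1, -, h2⟩
    exact ⟨h1, h2⟩

section Entropy

variable {S A : Type*} [Monoid S] [AddCommGroup A]

/-- The trajectory `T_F(α, X) = ∑_{s ∈ F} α(s)(X)` (a Minkowski sum of subsets of `A`). -/
def trajectory (α : S →* AddMonoid.End A) (F : Finset S) (X : Set A) : Set A :=
  ∑ s ∈ F, (α s) '' X

/-- `ℓ(T_F(α, X)) / |F|`. -/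
noncomputable def entropyRatio (α : S →* AddMonoid.End A) (X : Set A) (F : Finset S) : ℝ :=
  Real.log ((trajectory α F X).ncard : ℝ) / (F.card : ℝ)

/-- The algebraic entropy of `α` with respect to `X`: the limit of `ℓ(T_F(α, X)) / |F|` along
right Følner nets. -/
noncomputable def Halg (α : S →* AddMonoid.End A) (X : Set A) : ℝ :=
  limUnder (rightFolner S) (entropyRatio α X)

/-- The limits defining `Halg α X` are meaningful: there are right Følner nets, and for every
nonempty finite `X` the limit exists and does not depend on the net. -/
def HalgWellDefined (α : S →* AddMonoid.End A) : Prop :=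
  (rightFolner S).NeBot ∧
    ∀ X : Set A, X.Finite → X.Nonempty →
      Tendsto (entropyRatio α X) (rightFolner S) (𝓝 (Halg α X))

/-- The algebraic entropy `h_alg(α)`, a supremum over the nonempty finite subsets of `A`. -/
noncomputable def halg (α : S →* AddMonoid.End A) : EReal :=
  ⨆ X : {X : Set A // X.Finite ∧ X.Nonempty}, ((Halg α X.1 : ℝ) : EReal)

/-- The algebraic entropy `ent(α)`, a supremum over the finite subgroups of `A`. -/
noncomputable def ent (α : S →* AddMonoid.End A) : EReal :=
  ⨆ B : {B : AddSubgroup A // (B : Set A).Finite}, ((Halg α (B.1 : Set A) : ℝ) : EReal)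

end Entropy

/-- The restriction of an action of a group to a subgroup. -/
def restrict {G A : Type*} [Group G] [AddCommGroup A] (α : G →* AddMonoid.End A)
    (N : Subgroup G) : N →* AddMonoid.End A :=
  α.comp N.subtype

end AlgEntropy

/-! The limit is an infimum: along right Følner sets, `entropyRatio α X` converges to its infimum
over all non-empty finite subsets of the group (`tendsto_entropyRatio`). Finite subsets of `N` are
among those of `G` and give the same ratios, so the infimum over `N` is at least the one over `G`;
suprema over `X` preserve this.

The infimum rule rests on a Shearer inequality for Minkowski sums (`card_sum_pow_le_prod`). The
translates `s K` with `s ∈ F K⁻¹` cover each point of `F` exactly `|K|` times, whence `|T_F| ^ |K| ≤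
|T_K| ^ |F K⁻¹|`, and `|F K⁻¹| / |F|` tends to 1 along right Følner sets. The Minkowski version
reduces to the one for projections of sets of functions by choosing representations of the sums
minimally (`exists_minimal_representations`).

Følner nets come from an invariant mean, which rules out a paradoxical decomposition obtained from
Hall's marriage theorem; the mean passes to subgroups by pushforward. -/

namespace AlgEntropy

/-! ### Shearer's inequality, for projections and for Minkowski sums -/

section Shearer

open Classical in
/-- A form of Hölder's inequality for `k` sequences, with a constant factor. -/
theorem sum_pow_le_mul_prod_sum {ι κ : Type*} (s : Finset ι) (J : Finset κ) (hJ : J.Nonempty)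
    (v : ι → ℝ) (u : κ → ι → ℝ) (C : ℝ) (hC : 0 < C) (hs : s.Nonempty)
    (hv : ∀ a ∈ s, 0 ≤ v a) (hu : ∀ j ∈ J, ∀ a ∈ s, 0 < u j a)
    (h : ∀ a ∈ s, v a ^ J.card ≤ C * ∏ j ∈ J, u j a) :
    (∑ a ∈ s, v a) ^ J.card ≤ C * ∏ j ∈ J, ∑ a ∈ s, u j a := by
  have hk : J.card ≠ 0 := hJ.card_ne_zero
  have hk' : (0 : ℝ) < J.card := by exact_mod_cast Nat.pos_of_ne_zero hk
  have hX : ∀ j ∈ J, 0 < ∑ a ∈ s, u j a := fun j hj => Finset.sum_pos (hu j hj) hs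
  set P := C * ∏ j ∈ J, ∑ a ∈ s, u j a with hP
  have hP0 : 0 < P := mul_pos hC (Finset.prod_pos hX)
  obtain ⟨t, ht0, ht⟩ : ∃ t : ℝ, 0 < t ∧ t ^ J.card = P :=
    ⟨P ^ (J.card : ℝ)⁻¹, Real.rpow_pos_of_pos hP0 _, Real.rpow_inv_natCast_pow hP0.le hk⟩
  -- With each `u j` normalised to total mass 1, AM-GM applies pointwise; summing over `a` then
  -- gives an average of ones.
  have key : ∀ a ∈ s, v a / t ≤ (∑ j ∈ J, u j a / ∑ b ∈ s, u j b) / J.card := by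
    intro a ha
    have hz : ∀ j ∈ J, 0 ≤ u j a / ∑ b ∈ s, u j b := fun j hj =>
      div_nonneg (hu j hj a ha).le (hX j hj).le
    have amgm := Real.geom_mean_le_arith_mean J (fun _ => 1) (fun j => u j a / ∑ b ∈ s, u j b)
      (fun _ _ => zero_le_one) (by simpa using hJ) hz
    simp only [Real.rpow_one, Finset.sum_const, nsmul_eq_mul, mul_one, one_mul] at amgm
    refine le_trans ?_ amgm
    rw [← Real.pow_rpow_inv_natCast (div_nonneg (hv a ha) ht0.le) hk]
    refine Real.rpow_le_rpow (by have := hv a ha; positivity) ?_ (by positivity)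
    rw [div_pow, ht, Finset.prod_div_distrib, hP, div_le_div_iff₀ hP0 (Finset.prod_pos hX)]
    have := mul_le_mul_of_nonneg_right (h a ha) (Finset.prod_pos hX).le
    linarith
  have hsum : (∑ a ∈ s, v a) / t ≤ 1 := by
    rw [Finset.sum_div]
    refine (Finset.sum_le_sum key).trans ?_
    rw [← Finset.sum_div, Finset.sum_comm, div_le_one hk']
    calc ∑ j ∈ J, ∑ a ∈ s, u j a / ∑ b ∈ s, u j b = ∑ j ∈ J, (1 : ℝ) :=
          Finset.sum_congr rfl fun j hj => by rw [← Finset.sum_div, div_self (hX j hj).ne']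
      _ ≤ J.card := by simp
  rw [← ht]
  exact pow_le_pow_left₀ (Finset.sum_nonneg hv) ((div_le_one ht0).1 hsum) _

open Classical in
/-- The number of restrictions to `K` of the functions in `S`. -/
noncomputable def projCard {ι B : Type*} (K : Finset ι) (S : Finset (ι → B)) : ℕ :=
  (S.image K.restrict).card

open Classical in
theorem projCard_pos {ι B : Type*} (K : Finset ι) {S : Finset (ι → B)} (hS : S.Nonempty) :
    0 < projCard K S :=
  Finset.card_pos.2 (hS.image _)

open Classical in
theorem projCard_mono {ι B : Type*} (K : Finset ι) {S T : Finset (ι → B)} (h : S ⊆ T) :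
    projCard K S ≤ projCard K T :=
  Finset.card_le_card (Finset.image_subset_image h)

open Classical in
theorem projCard_eq_sum {ι B : Type*} {K : Finset ι} {i : ι} (hi : i ∈ K) (S : Finset (ι → B)) :
    projCard K S = ∑ a ∈ S.image (fun x => x i), projCard K (S.filter fun x => x i = a) := by
  unfold projCard
  rw [Finset.card_eq_sum_card_fiberwise (f := fun y : K → B => y ⟨i, hi⟩)
    (t := S.image fun x => x i)]
  · refine Finset.sum_congr rfl fun a _ => ?_
    congr 1
    ext y
    simp only [Finset.mem_filter, Finset.mem_image]
    constructor
    · rintro ⟨⟨x, hx, rfl⟩, h⟩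
      exact ⟨x, ⟨hx, h⟩, rfl⟩
    · rintro ⟨x, ⟨hx, h⟩, rfl⟩
      exact ⟨⟨x, hx, rfl⟩, h⟩
  · intro y hy
    obtain ⟨x, hx, rfl⟩ := Finset.mem_image.1 (Finset.mem_coe.1 hy)
    exact Finset.mem_coe.2 (Finset.mem_image.2 ⟨x, hx, rfl⟩)

-- Forgetting a coordinate that is constant on `S` loses no information.
open Classical in
theorem projCard_insert_le {ι B : Type*} (F : Finset ι) (i : ι) (S : Finset (ι → B)) (a : B)
    (hS : ∀ x ∈ S, x i = a) : projCard (insert i F) S ≤ projCard F S := by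
  refine Finset.card_le_card_of_injOn
    (Finset.restrict₂ (π := fun _ => B) (Finset.subset_insert i F)) ?_ ?_
  · intro y hy
    obtain ⟨x, hx, rfl⟩ := Finset.mem_image.1 (Finset.mem_coe.1 hy)
    exact Finset.mem_coe.2 (Finset.mem_image.2 ⟨x, hx, rfl⟩)
  · intro y hy z hz h
    obtain ⟨x, hx, rfl⟩ := Finset.mem_image.1 (Finset.mem_coe.1 hy)
    obtain ⟨w, hw, rfl⟩ := Finset.mem_image.1 (Finset.mem_coe.1 hz)
    funext ⟨j, hj⟩
    rcases Finset.mem_insert.1 hj with rfl | hj'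
    · exact (hS x hx).trans (hS w hw).symm
    · exact congrFun h ⟨j, hj'⟩

open Classical in
/-- **Shearer's inequality**, for finite sets of functions. -/
theorem projCard_pow_le_prod {ι κ B : Type*} (F : Finset ι) (J : Finset κ) (K : κ → Finset ι)
    {k : ℕ} (hk : k ≠ 0) (hF : ∀ i ∈ F, (J.filter fun j => i ∈ K j).card = k)
    (S : Finset (ι → B)) (hS : S.Nonempty) :
    (projCard F S : ℝ) ^ k ≤ ∏ j ∈ J, (projCard (K j) S : ℝ) := by
  have one_le : ∀ (L : Finset ι) {S : Finset (ι → B)}, S.Nonempty → (1 : ℝ) ≤ projCard L S :=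
    fun L S h => by exact_mod_cast projCard_pos L h
  induction F using Finset.induction_on generalizing S with
  | empty =>
    have : projCard (∅ : Finset ι) S ≤ 1 :=
      (Finset.card_le_univ _).trans (by simp)
    calc (projCard (∅ : Finset ι) S : ℝ) ^ k ≤ 1 :=
          pow_le_one₀ (by positivity) (by exact_mod_cast this)
      _ ≤ _ := Finset.one_le_prod fun j _ => one_le _ hS
  | insert i F _ ih =>
    have hcard := hF i (Finset.mem_insert_self i F)
    have hslice : ∀ a ∈ S.image (fun x => x i), (S.filter fun x => x i = a).Nonempty := by
      intro a ha
      obtain ⟨x, hx, rfl⟩ := Finset.mem_image.1 ha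
      exact ⟨x, Finset.mem_filter.2 ⟨hx, rfl⟩⟩
    have hle : projCard (insert i F) S ≤
        ∑ a ∈ S.image (fun x => x i), projCard F (S.filter fun x => x i = a) := by
      rw [projCard_eq_sum (Finset.mem_insert_self i F)]
      exact Finset.sum_le_sum fun a _ =>
        projCard_insert_le F i _ a fun x hx => (Finset.mem_filter.1 hx).2
    have hle' : (projCard (insert i F) S : ℝ) ≤
        ∑ a ∈ S.image (fun x => x i), (projCard F (S.filter fun x => x i = a) : ℝ) := by
      exact_mod_cast hle
    refine (pow_le_pow_left₀ (by positivity) hle' k).trans ?_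
    -- Slice by the value at `i`. The `k` sets `K j` containing `i` have projections that split over
    -- the slices; the others are bounded by their value on all of `S` and form the constant.
    have holder := sum_pow_le_mul_prod_sum (S.image fun x => x i) (J.filter fun j => i ∈ K j)
      (by rw [← Finset.card_pos, hcard]; omega)
      (fun a => (projCard F (S.filter fun x => x i = a) : ℝ))
      (fun j a => (projCard (K j) (S.filter fun x => x i = a) : ℝ))
      (∏ j ∈ J.filter (fun j => i ∉ K j), (projCard (K j) S : ℝ))
      (Finset.prod_pos fun j _ => zero_lt_one.trans_le (one_le _ hS)) (hS.image _)
      (fun a _ => by positivity)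
      (fun j _ a ha => zero_lt_one.trans_le (one_le _ (hslice a ha)))
      (by
        intro a ha
        rw [hcard]
        refine (ih (fun i' hi' => hF i' (Finset.mem_insert_of_mem hi')) _ (hslice a ha)).trans ?_
        rw [← Finset.prod_filter_mul_prod_filter_not J (fun j => i ∈ K j), mul_comm]
        refine mul_le_mul_of_nonneg_right ?_ (by positivity)
        exact Finset.prod_le_prod (fun _ _ => by positivity) fun j _ => by
          exact_mod_cast projCard_mono _ (Finset.filter_subset _ _))
    rw [hcard] at holder
    refine holder.trans (le_of_eq ?_)
    rw [← Finset.prod_filter_mul_prod_filter_not J (fun j => i ∈ K j), mul_comm]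
    congr 1
    refine Finset.prod_congr rfl fun j hj => ?_
    rw [projCard_eq_sum (Finset.mem_filter.1 hj).2 S]
    push_cast
    rfl

open Classical in
/-- Representations of the elements of a Minkowski sum can be chosen so that their partial
sums determine the corresponding partial representations. -/
theorem exists_minimal_representations {ι A : Type*} [AddCommGroup A] (Y : ι → Finset A)
    (F : Finset ι) :
    ∃ S : Finset (ι → A), (∀ a ∈ ∑ i ∈ F, Y i, ∃ x ∈ S, ∑ i ∈ F, x i = a) ∧
      (∀ x ∈ S, ∀ i ∈ F, x i ∈ Y i) ∧
      ∀ K ⊆ F, ∀ x ∈ S, ∀ y ∈ S, ∑ i ∈ K, x i = ∑ i ∈ K, y i → ∀ i ∈ K, x i = y i := by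
  have sum_mem : ∀ (F : Finset ι) (x : ι → A), (∀ i ∈ F, x i ∈ Y i) →
      ∑ i ∈ F, x i ∈ ∑ i ∈ F, Y i := by
    intro F x hx
    rw [← Finset.mem_coe, Finset.coe_sum]
    exact Set.finsetSum_mem_finsetSum _ _ _ hx
  induction F using Finset.induction_on with
  | empty =>
    refine ⟨{0}, ?_, by simp, ?_⟩
    · intro a ha
      simpa [eq_comm] using ha
    · intro K hK x _ y _ _ i hi
      exact absurd (hK hi) (Finset.notMem_empty i)
  | insert i F hi ih =>
    obtain ⟨S, hS1, hS2, hS3⟩ := ih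
    -- The injection into `ℕ` orders `Y i`; each sum gets the representation whose `i`-th term is
    -- least, completed by the representation already chosen over `F`.
    obtain ⟨e, he⟩ := Set.countable_iff_exists_injOn.1 (Y i).finite_toSet.countable
    have key : ∀ t ∈ ∑ j ∈ insert i F, Y j, ∃ z : ι → A, ∑ j ∈ insert i F, z j = t ∧ z i ∈ Y i ∧
        (∃ x ∈ S, ∀ j ∈ F, z j = x j) ∧
        ∀ b ∈ Y i, t - b ∈ ∑ j ∈ F, Y j → e (z i) ≤ e b := by
      intro t ht
      rw [Finset.sum_insert hi, Finset.mem_add] at ht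
      obtain ⟨a, ha, c, hc, rfl⟩ := ht
      obtain ⟨m, hm, hmin⟩ := Finset.exists_min_image
        ((Y i).filter fun b => a + c - b ∈ ∑ j ∈ F, Y j) e
        ⟨a, Finset.mem_filter.2 ⟨ha, by simpa using hc⟩⟩
      obtain ⟨hm1, hm2⟩ := Finset.mem_filter.1 hm
      obtain ⟨x, hx, hxs⟩ := hS1 _ hm2
      have hF : ∀ j ∈ F, Function.update x i m j = x j := fun j hj =>
        Function.update_of_ne (ne_of_mem_of_not_mem hj hi) _ _
      refine ⟨Function.update x i m, ?_, by simpa using hm1, ⟨x, hx, hF⟩, ?_⟩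
      · rw [Finset.sum_insert hi, Finset.sum_congr rfl hF, hxs]
        simp
      · intro b hb hb'
        simpa using hmin b (Finset.mem_filter.2 ⟨hb, hb'⟩)
    choose! g hg1 hg2 hg3 hg4 using key
    have hY : ∀ t ∈ ∑ j ∈ insert i F, Y j, ∀ j ∈ insert i F, g t j ∈ Y j := by
      intro t ht j hj
      rcases Finset.mem_insert.1 hj with rfl | hj
      · exact hg2 t ht
      · obtain ⟨x, hx, hxz⟩ := hg3 t ht
        rw [hxz j hj]
        exact hS2 x hx j hj
    have hF : ∀ K ⊆ F, ∀ t ∈ ∑ j ∈ insert i F, Y j, ∀ t' ∈ ∑ j ∈ insert i F, Y j,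
        ∑ j ∈ K, g t j = ∑ j ∈ K, g t' j → ∀ j ∈ K, g t j = g t' j := by
      intro K hK t ht t' ht' h j hj
      obtain ⟨x, hx, hxz⟩ := hg3 t ht
      obtain ⟨y, hy, hyz⟩ := hg3 t' ht'
      rw [Finset.sum_congr rfl fun j hj => hxz j (hK hj),
        Finset.sum_congr rfl fun j hj => hyz j (hK hj)] at h
      rw [hxz j (hK hj), hyz j (hK hj)]
      exact hS3 K hK x hx y hy h j hj
    have hmin : ∀ K ⊆ insert i F, i ∈ K → ∀ t ∈ ∑ j ∈ insert i F, Y j,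
        ∀ t' ∈ ∑ j ∈ insert i F, Y j, ∑ j ∈ K, g t j = ∑ j ∈ K, g t' j →
        e (g t i) ≤ e (g t' i) := by
      intro K hK hiK t ht t' ht' h
      refine hg4 t ht _ (hg2 t' ht') ?_
      -- Exchange argument: as the partial sums over `K` agree, replacing the terms of `g t` on `K`
      -- by those of `g t'` still represents `t`, so `g t' i` competes in the minimum defining `g t
      -- i`.
      set u : ι → A := K.piecewise (g t') (g t) with hu
      have hsum : ∑ j ∈ insert i F, u j = t := by
        rw [← hg1 t ht, ← Finset.sum_sdiff hK, ← Finset.sum_sdiff hK, h]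
        congr 1
        · exact Finset.sum_congr rfl fun j hj =>
            Finset.piecewise_eq_of_notMem _ _ _ (Finset.mem_sdiff.1 hj).2
        · exact Finset.sum_congr rfl fun j hj => Finset.piecewise_eq_of_mem _ _ _ hj
      have hui : u i = g t' i := Finset.piecewise_eq_of_mem _ _ _ hiK
      have : t - g t' i = ∑ j ∈ F, u j := by
        rw [← hsum, Finset.sum_insert hi, hui]
        abel
      rw [this]
      refine sum_mem F u fun j hj => ?_
      by_cases hjK : j ∈ K
      · rw [hu, Finset.piecewise_eq_of_mem _ _ _ hjK]
        exact hY t' ht' j (Finset.mem_insert_of_mem hj)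
      · rw [hu, Finset.piecewise_eq_of_notMem _ _ _ hjK]
        exact hY t ht j (Finset.mem_insert_of_mem hj)
    refine ⟨(∑ j ∈ insert i F, Y j).image g, ?_, ?_, ?_⟩
    · exact fun t ht => ⟨g t, Finset.mem_image_of_mem g ht, hg1 t ht⟩
    · intro z hz
      obtain ⟨t, ht, rfl⟩ := Finset.mem_image.1 hz
      exact hY t ht
    · intro K hK z hz w hw h
      obtain ⟨t, ht, rfl⟩ := Finset.mem_image.1 hz
      obtain ⟨t', ht', rfl⟩ := Finset.mem_image.1 hw
      by_cases hiK : i ∈ K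
      · have hii : g t i = g t' i := he (hg2 t ht) (hg2 t' ht')
          (le_antisymm (hmin K hK hiK t ht t' ht' h) (hmin K hK hiK t' ht' t ht h.symm))
        rw [← Finset.add_sum_erase _ _ hiK, ← Finset.add_sum_erase _ _ hiK, hii,
          add_right_inj] at h
        have hK' : K.erase i ⊆ F := by
          intro j hj
          obtain ⟨hji, hjK⟩ := Finset.mem_erase.1 hj
          exact (Finset.mem_insert.1 (hK hjK)).resolve_left hji
        intro j hj
        by_cases hji : j = i
        · rw [hji, hii]
        · exact hF _ hK' t ht t' ht' h j (Finset.mem_erase.2 ⟨hji, hj⟩)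
      · refine hF K ?_ t ht t' ht' h
        intro j hj
        exact (Finset.mem_insert.1 (hK hj)).resolve_left fun hji => hiK (hji ▸ hj)

open Classical in
/-- **Shearer's inequality** for Minkowski sums in an abelian group. -/
theorem card_sum_pow_le_prod {ι κ A : Type*} [AddCommGroup A] (Y : ι → Finset A)
    (hY : ∀ i, (Y i).Nonempty) (F : Finset ι) (J : Finset κ) (K : κ → Finset ι) {k : ℕ}
    (hk : k ≠ 0) (hF : ∀ i ∈ F, (J.filter fun j => i ∈ K j).card = k) :
    ((∑ i ∈ F, Y i).card : ℝ) ^ k ≤ ∏ j ∈ J, ((∑ i ∈ K j, Y i).card : ℝ) := by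
  have hne : ∀ L : Finset ι, (∑ i ∈ L, Y i).Nonempty := by
    intro L
    choose y hy using hY
    refine ⟨∑ i ∈ L, y i, ?_⟩
    rw [← Finset.mem_coe, Finset.coe_sum]
    exact Set.finsetSum_mem_finsetSum _ _ _ fun i _ => hy i
  obtain ⟨S, hS1, hS2, hS3⟩ := exists_minimal_representations Y F
  have hSne : S.Nonempty := by
    obtain ⟨a, ha⟩ := hne F
    obtain ⟨x, hx, -⟩ := hS1 a ha
    exact ⟨x, hx⟩
  have h1 : (∑ i ∈ F, Y i).card ≤ projCard F S := by
    refine Finset.card_le_card_of_surjOn (fun y : F → A => ∑ i, y i) ?_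
    intro a ha
    obtain ⟨x, hx, rfl⟩ := hS1 a ha
    exact ⟨F.restrict x, Finset.mem_coe.2 (Finset.mem_image_of_mem _ hx),
      Finset.sum_coe_sort F x⟩
  have h2 : ∀ L ⊆ F, projCard L S ≤ (∑ i ∈ L, Y i).card := by
    intro L hL
    refine Finset.card_le_card_of_injOn (fun y : L → A => ∑ i, y i) ?_ ?_
    · intro y hy
      obtain ⟨x, hx, rfl⟩ := Finset.mem_image.1 (Finset.mem_coe.1 hy)
      have : ∑ i : L, L.restrict x i = ∑ i ∈ L, x i := Finset.sum_coe_sort L x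
      simp only [this, Finset.coe_sum]
      exact Set.finsetSum_mem_finsetSum _ _ _ fun i hi => hS2 x hx i (hL hi)
    · intro y hy z hz h
      obtain ⟨x, hx, rfl⟩ := Finset.mem_image.1 (Finset.mem_coe.1 hy)
      obtain ⟨w, hw, rfl⟩ := Finset.mem_image.1 (Finset.mem_coe.1 hz)
      have e1 : ∑ i : L, L.restrict x i = ∑ i ∈ L, x i := Finset.sum_coe_sort L x
      have e2 : ∑ i : L, L.restrict w i = ∑ i ∈ L, w i := Finset.sum_coe_sort L w
      simp only [e1, e2] at h
      funext ⟨j, hj⟩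
      exact hS3 L hL x hx w hw h j hj
  -- The representations are controlled only on `F`, so each `K j` is cut down to `F`; restoring the
  -- missing summands cannot shrink a Minkowski sum.
  have hF' : ∀ i ∈ F, (J.filter fun j => i ∈ K j ∩ F).card = k := by
    intro i hi
    rw [← hF i hi]
    congr 1
    exact Finset.filter_congr fun j _ => by simp [hi]
  calc ((∑ i ∈ F, Y i).card : ℝ) ^ k ≤ (projCard F S : ℝ) ^ k :=
        pow_le_pow_left₀ (by positivity) (by exact_mod_cast h1) k
    _ ≤ ∏ j ∈ J, (projCard (K j ∩ F) S : ℝ) :=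
        projCard_pow_le_prod F J (fun j => K j ∩ F) hk hF' S hSne
    _ ≤ ∏ j ∈ J, ((∑ i ∈ K j, Y i).card : ℝ) := by
        refine Finset.prod_le_prod (fun _ _ => by positivity) fun j _ => ?_
        have : projCard (K j ∩ F) S ≤ (∑ i ∈ K j, Y i).card := by
          refine (h2 _ Finset.inter_subset_right).trans ?_
          rw [← Finset.sum_sdiff (Finset.inter_subset_left : K j ∩ F ⊆ K j)]
          exact Finset.card_le_card_add_left (hne _)
        exact_mod_cast this

end Shearer

/-! ### Invariant means and existence of right Følner nets -/

section Folner

/-- A group has a right invariant finitely additive probability measure on all of its subsets. -/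
def HasRightInvariantMean (G : Type*) [Group G] : Prop :=
  ∃ μ : Set G → ℝ,
    (∀ F, 0 ≤ μ F ∧ μ F ≤ 1) ∧
    μ Set.univ = 1 ∧
    (∀ E F, Disjoint E F → μ (E ∪ F) = μ E + μ F) ∧
    ∀ (s : G) (F : Set G), μ ((fun x => x * s) ⁻¹' F) = μ F

theorem IsRightAmenable.hasRightInvariantMean {G : Type*} [Group G] (h : IsRightAmenable G) :
    HasRightInvariantMean G := by
  obtain ⟨ν, h1, h2, h3, h4⟩ := h
  refine ⟨fun F => ν (MulOpposite.unop ⁻¹' F), fun F => h1 _, h2, fun E F hEF => ?_,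
    fun s F => ?_⟩
  · exact h3 _ _ (hEF.preimage _)
  · exact h4 (MulOpposite.op s) (MulOpposite.unop ⁻¹' F)

/-- Dividing each element by the representative of its left coset gives a map `G → H` commuting with
right multiplication by `H`, so the mean can be pushed forward along it. -/
theorem HasRightInvariantMean.subgroup {G : Type*} [Group G] (h : HasRightInvariantMean G)
    (H : Subgroup G) : HasRightInvariantMean H := by
  obtain ⟨μ, h1, h2, h3, h4⟩ := h
  set r : G → H := fun g => ⟨((g : G ⧸ H).out)⁻¹ * g,
    QuotientGroup.eq.1 (QuotientGroup.out_eq' (g : G ⧸ H))⟩ with hr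
  have hmul : ∀ (g : G) (n : H), r (g * n) = r g * n := by
    intro g n
    have : ((g * n : G) : G ⧸ H) = (g : G ⧸ H) := QuotientGroup.mk_mul_of_mem g n.2
    ext
    simp only [hr, this, Subgroup.coe_mul, mul_assoc]
  refine ⟨fun F => μ (r ⁻¹' F), fun F => h1 _, h2, fun E F hEF => ?_, fun s F => ?_⟩
  · exact h3 _ _ (hEF.preimage _)
  · refine Eq.trans ?_ (h4 (s : G) (r ⁻¹' F))
    refine congrArg μ ?_
    ext g
    simp [hmul]

theorem measure_biUnion_finset_of_additive {X ι : Type*} {μ : Set X → ℝ}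
    (hμ : ∀ E F, Disjoint E F → μ (E ∪ F) = μ E + μ F) (s : Finset ι) (B : ι → Set X)
    (hB : (s : Set ι).PairwiseDisjoint B) : μ (⋃ i ∈ s, B i) = ∑ i ∈ s, μ (B i) := by
  classical
  have h0 : μ ∅ = 0 := by
    have := hμ ∅ ∅ disjoint_bot_left
    simpa using this
  induction s using Finset.induction_on with
  | empty => simpa using h0
  | insert i s hi ih =>
    rw [Finset.set_biUnion_insert, hμ, Finset.sum_insert hi,
      ih (hB.subset (Finset.coe_subset.2 (Finset.subset_insert i s)))]
    refine Set.disjoint_iUnion₂_right.2 fun j hj => ?_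
    exact hB (Finset.mem_insert_self i s) (Finset.mem_insert_of_mem hj)
      (ne_of_mem_of_not_mem hj hi).symm

open Classical in
/-- In a group with a right invariant mean, no finite set `L` doubles all finite sets. -/
theorem HasRightInvariantMean.exists_card_mul_lt {G : Type*} [Group G]
    (h : HasRightInvariantMean G) (L : Finset G) :
    ∃ F : Finset G, (F * L).card < 2 * F.card := by
  obtain ⟨μ, h1, h2, h3, h4⟩ := h
  by_contra! hL
  -- If `L` doubled every finite set, Hall's condition would hold for two copies of `G`, giving an
  -- injection `f` with `f (x, b) ∈ x L`.
  obtain ⟨f, hf, hft⟩ := (Finset.all_card_le_biUnion_card_iff_exists_injective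
    (fun p : G × Bool => L.image fun k => p.1 * k)).1 (by
      intro s
      calc s.card ≤ (s.image Prod.fst ×ˢ (Finset.univ : Finset Bool)).card := by
            refine Finset.card_le_card fun p hp => ?_
            exact Finset.mem_product.2 ⟨Finset.mem_image_of_mem _ hp, Finset.mem_univ _⟩
        _ = 2 * (s.image Prod.fst).card := by
            rw [Finset.card_product, Finset.card_univ, Fintype.card_bool, mul_comm]
        _ ≤ (s.image Prod.fst * L).card := hL _
        _ ≤ _ := by
            refine Finset.card_le_card fun y hy => ?_
            obtain ⟨x, hx, k, hk, rfl⟩ := Finset.mem_mul.1 hy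
            obtain ⟨p, hp, rfl⟩ := Finset.mem_image.1 hx
            exact Finset.mem_biUnion.2 ⟨p, hp, Finset.mem_image_of_mem _ hk⟩)
  -- For each `b`, the sets `A (b, k)` with `k ∈ L` partition `G`. Their right translates by `k` are
  -- disjoint over all pairs `(b, k)`, because `f` is injective, so they would have total mass 2.
  set A : Bool × G → Set G := fun q => {x | f (x, q.1) = x * q.2} with hA
  have hAsum : ∀ b : Bool, ∑ k ∈ L, μ (A (b, k)) = 1 := by
    intro b
    rw [← measure_biUnion_finset_of_additive h3 L fun k => A (b, k), ← h2]
    · congr 1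
      refine Set.eq_univ_of_forall fun x => ?_
      obtain ⟨k, hk, hkx⟩ := Finset.mem_image.1 (hft (x, b))
      exact Set.mem_iUnion₂.2 ⟨k, hk, hkx.symm⟩
    · intro k _ k' _ hne
      refine Set.disjoint_left.2 fun x hx hx' => hne ?_
      exact mul_left_cancel ((show f (x, b) = x * k from hx).symm.trans hx')
  have hdisj : (((Finset.univ : Finset Bool) ×ˢ L : Finset (Bool × G)) :
      Set (Bool × G)).PairwiseDisjoint fun q => (fun x => x * q.2⁻¹) ⁻¹' A q := by
    rintro ⟨b, k⟩ _ ⟨b', k'⟩ _ hne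
    refine Set.disjoint_left.2 fun y hy hy' => hne ?_
    have e1 : f (y * k⁻¹, b) = y := by simpa [hA] using hy
    have e2 : f (y * k'⁻¹, b') = y := by simpa [hA] using hy'
    have := hf (e1.trans e2.symm)
    simpa [eq_comm, and_comm] using this
  have hle := (h1 (⋃ q ∈ (Finset.univ : Finset Bool) ×ˢ L, (fun x => x * q.2⁻¹) ⁻¹' A q)).2
  rw [measure_biUnion_finset_of_additive h3 _ _ hdisj, Finset.sum_product] at hle
  simp only [h4, hAsum] at hle
  norm_num at hle

-- Otherwise multiplying by `insert 1 K` enlarges every non-empty finite set by a factor `1 + ε`,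
-- and some power of `insert 1 K` doubles them all.
open Classical in
theorem HasRightInvariantMean.exists_rightDefect_lt {G : Type*} [Group G]
    (h : HasRightInvariantMean G) (K : Finset G) {ε : ℝ} (hε : 0 < ε) :
    ∃ F : Finset G, F.Nonempty ∧ ∀ s ∈ K, rightDefect s F < ε := by
  by_contra! hK
  have hgrow : ∀ F : Finset G, F.Nonempty → (1 + ε) * F.card ≤ (F * insert 1 K).card := by
    intro F hF
    obtain ⟨s, hs, hsF⟩ := hK F hF
    have hpos : (0 : ℝ) < F.card := by exact_mod_cast hF.card_pos
    rw [rightDefect, le_div_iff₀ hpos] at hsF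
    have hsub : F ∪ (F.image (fun x => x * s) \ F) ⊆ F * insert 1 K := by
      intro y hy
      rcases Finset.mem_union.1 hy with hy | hy
      · exact Finset.mem_mul.2 ⟨y, hy, 1, Finset.mem_insert_self _ _, mul_one y⟩
      · obtain ⟨x, hx, rfl⟩ := Finset.mem_image.1 (Finset.mem_sdiff.1 hy).1
        exact Finset.mul_mem_mul hx (Finset.mem_insert_of_mem hs)
    have hcard := Finset.card_le_card hsub
    rw [Finset.card_union_of_disjoint Finset.disjoint_sdiff] at hcard
    have : (F.card : ℝ) + (F.image (fun x => x * s) \ F).card ≤ (F * insert 1 K).card := by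
      exact_mod_cast hcard
    linarith
  have hpow : ∀ (n : ℕ) (F : Finset G), F.Nonempty →
      (1 + ε) ^ n * F.card ≤ (F * (insert 1 K) ^ n).card := by
    intro n F hF
    induction n with
    | zero => simp
    | succ n ih =>
      rw [pow_succ (insert 1 K), ← mul_assoc, pow_succ']
      refine le_trans ?_ (hgrow _ (hF.mul ((Finset.insert_nonempty 1 K).pow)))
      rw [mul_assoc]
      exact mul_le_mul_of_nonneg_left ih (by positivity)
  obtain ⟨n, hn⟩ := pow_unbounded_of_one_lt 2 (show 1 < 1 + ε by linarith)
  obtain ⟨F, hF⟩ := h.exists_card_mul_lt ((insert 1 K) ^ n)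
  have hFne : F.Nonempty := by
    rw [← Finset.card_pos]
    omega
  have h1 := hpow n F hFne
  have h2 : ((F * (insert 1 K) ^ n).card : ℝ) < 2 * F.card := by exact_mod_cast hF
  have h3 : (2 : ℝ) * F.card ≤ (1 + ε) ^ n * F.card :=
    mul_le_mul_of_nonneg_right hn.le (by positivity)
  linarith

/-- Existence of right Følner nets. -/
theorem HasRightInvariantMean.rightFolner_neBot {G : Type*} [Group G]
    (h : HasRightInvariantMean G) : (rightFolner G).NeBot := by
  classical
  choose F hF1 hF2 using fun p : Finset G × ℕ =>
    h.exists_rightDefect_lt p.1 (ε := 1 / ((p.2 : ℝ) + 1)) (by positivity)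
  have hnet : IsRightFolnerNet F := by
    refine ⟨hF1, fun s => ?_⟩
    have hlim : Tendsto (fun p : Finset G × ℕ => 1 / ((p.2 : ℝ) + 1)) atTop (𝓝 0) :=
      tendsto_one_div_add_atTop_nhds_zero_nat.comp
        (by rw [← prod_atTop_atTop_eq]; exact tendsto_snd)
    refine tendsto_of_tendsto_of_tendsto_of_le_of_le' tendsto_const_nhds hlim
      (Eventually.of_forall fun p => by unfold rightDefect; positivity) ?_
    filter_upwards [eventually_ge_atTop (({s}, 0) : Finset G × ℕ)] with p hp
    exact (hF2 p s (hp.1 (Finset.mem_singleton_self s))).le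
  exact ((isRightFolnerNet_iff F).1 hnet).2.neBot

end Folner

/-! ### The infimum rule and comparison with the subgroup -/

section Limit

variable {S A : Type*} [Group S] [AddCommGroup A]

open Classical in
theorem trajectory_eq_coe (α : S →* AddMonoid.End A)
    (F : Finset S) (X : Finset A) :
    trajectory α F X = ((∑ s ∈ F, X.image (α s) : Finset A) : Set A) := by
  simp [trajectory]

theorem trajectory_finite (α : S →* AddMonoid.End A) (F : Finset S) {X : Set A} (hX : X.Finite) :
    (trajectory α F X).Finite := by
  classical
  lift X to Finset A using hX
  rw [trajectory_eq_coe]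
  exact Finset.finite_toSet _

theorem trajectory_nonempty (α : S →* AddMonoid.End A) (F : Finset S) {X : Set A}
    (hX : X.Nonempty) : (trajectory α F X).Nonempty := by
  obtain ⟨x, hx⟩ := hX
  exact ⟨∑ s ∈ F, α s x, Set.finsetSum_mem_finsetSum _ _ _ fun s _ => Set.mem_image_of_mem _ hx⟩

theorem one_le_ncard_trajectory (α : S →* AddMonoid.End A) (F : Finset S) {X : Set A}
    (hX : X.Finite) (hX' : X.Nonempty) : 1 ≤ (trajectory α F X).ncard :=
  (Set.ncard_pos (trajectory_finite α F hX)).2 (trajectory_nonempty α F hX')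

open Classical in
theorem trajectory_image_mul_left (α : S →* AddMonoid.End A) (F : Finset S) (X : Set A) (s : S) :
    trajectory α (F.image fun x => s * x) X = α s '' trajectory α F X := by
  unfold trajectory
  rw [Finset.sum_image fun x _ y _ h => mul_left_cancel h, Set.image_finsetSum]
  refine Finset.sum_congr rfl fun x _ => ?_
  rw [map_mul, Set.image_image]
  rfl

theorem entropyRatio_nonneg (α : S →* AddMonoid.End A) (X : Set A) (F : Finset S) :
    0 ≤ entropyRatio α X F :=
  div_nonneg (Real.log_natCast_nonneg _) (Nat.cast_nonneg _)

-- Shearer's inequality for the cover of `F` by the translates `s K`, `s ∈ F K⁻¹`: a point `x ∈ F`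
-- lies in `s K` exactly when `s = x k⁻¹` for some `k ∈ K`. The trajectory of `s K` is the image
-- under `α s` of that of `K`, hence no larger.
open Classical in
theorem card_mul_log_ncard_trajectory_le (α : S →* AddMonoid.End A) {X : Set A} (hX : X.Finite)
    (hX' : X.Nonempty) (F : Finset S) {K : Finset S} (hK : K.Nonempty) :
    K.card * Real.log (trajectory α F X).ncard ≤
      (F * K⁻¹).card * Real.log (trajectory α K X).ncard := by
  have hpos : ∀ L : Finset S, (0 : ℝ) < (trajectory α L X).ncard := fun L => by
    exact_mod_cast one_le_ncard_trajectory α L hX hX'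
  have hcover : ∀ x ∈ F,
      ((F * K⁻¹).filter fun s => x ∈ K.image fun k => s * k).card = K.card := by
    intro x hx
    rw [← Finset.card_image_of_injective K
      (f := fun k => x * k⁻¹) fun a b h => inv_injective (mul_left_cancel h)]
    congr 1
    ext s
    simp only [Finset.mem_filter, Finset.mem_image]
    constructor
    · rintro ⟨-, k, hk, rfl⟩
      exact ⟨k, hk, by simp⟩
    · rintro ⟨k, hk, rfl⟩
      exact ⟨Finset.mul_mem_mul hx (Finset.inv_mem_inv hk), k, hk, by simp⟩
  have hshearer : ((trajectory α F X).ncard : ℝ) ^ K.card ≤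
      ∏ s ∈ F * K⁻¹, ((trajectory α (K.image fun k => s * k) X).ncard : ℝ) := by
    have := card_sum_pow_le_prod (fun s => hX.toFinset.image (α s))
      (fun s => (hX.toFinset_nonempty.2 hX').image _) F (F * K⁻¹)
      (fun s => K.image fun k => s * k) hK.card_ne_zero hcover
    have e : ∀ L : Finset S, (trajectory α L X).ncard =
        (∑ s ∈ L, hX.toFinset.image (α s)).card := by
      intro L
      rw [← Set.ncard_coe_finset, ← trajectory_eq_coe, hX.coe_toFinset]
    simpa only [e] using this
  have hbound : ((trajectory α F X).ncard : ℝ) ^ K.card ≤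
      ((trajectory α K X).ncard : ℝ) ^ (F * K⁻¹).card := by
    refine hshearer.trans ?_
    rw [← Finset.prod_const]
    refine Finset.prod_le_prod (fun _ _ => by positivity) fun s _ => ?_
    rw [trajectory_image_mul_left]
    exact_mod_cast Set.ncard_image_le (trajectory_finite α K hX)
  have := Real.log_le_log (pow_pos (hpos F) _) hbound
  rwa [Real.log_pow, Real.log_pow] at this

-- A point of `F K⁻¹` outside `F` is counted by the defect of some `k⁻¹`, so `|F K⁻¹|` exceeds `|F|`
-- by a negligible amount along Følner sets.
open Classical in
theorem card_mul_inv_le (F K : Finset S) :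
    (F * K⁻¹).card ≤ F.card + ∑ k ∈ K, (F.image (fun x => x * k⁻¹) \ F).card := by
  have hsub : F * K⁻¹ ⊆ F ∪ K.biUnion fun k => F.image (fun x => x * k⁻¹) \ F := by
    intro y hy
    obtain ⟨x, hx, l, hl, rfl⟩ := Finset.mem_mul.1 hy
    by_cases h : x * l ∈ F
    · exact Finset.mem_union_left _ h
    · refine Finset.mem_union_right _ (Finset.mem_biUnion.2 ⟨l⁻¹, Finset.mem_inv'.1 hl, ?_⟩)
      exact Finset.mem_sdiff.2 ⟨Finset.mem_image.2 ⟨x, hx, by simp⟩, h⟩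
  calc (F * K⁻¹).card ≤ _ := Finset.card_le_card hsub
    _ ≤ F.card + (K.biUnion fun k => F.image (fun x => x * k⁻¹) \ F).card :=
        Finset.card_union_le _ _
    _ ≤ _ := Nat.add_le_add_left Finset.card_biUnion_le _

theorem entropyRatio_le_mul (α : S →* AddMonoid.End A) {X : Set A} (hX : X.Finite)
    (hX' : X.Nonempty) {F : Finset S} (hF : F.Nonempty) {K : Finset S} (hK : K.Nonempty) :
    entropyRatio α X F ≤ (1 + ∑ k ∈ K, rightDefect k⁻¹ F) * entropyRatio α X K := by
  classical
  have hF0 : (0 : ℝ) < F.card := by exact_mod_cast hF.card_pos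
  have hK0 : (0 : ℝ) < K.card := by exact_mod_cast hK.card_pos
  have hl : 0 ≤ Real.log (trajectory α K X).ncard := Real.log_natCast_nonneg _
  have h1 := card_mul_log_ncard_trajectory_le α hX hX' F hK
  have h2 : ((F * K⁻¹).card : ℝ) ≤ (1 + ∑ k ∈ K, rightDefect k⁻¹ F) * F.card := by
    have : ((F * K⁻¹).card : ℝ) ≤
        F.card + ∑ k ∈ K, ((F.image (fun x => x * k⁻¹) \ F).card : ℝ) := by
      exact_mod_cast card_mul_inv_le F K
    refine this.trans (le_of_eq ?_)
    rw [add_mul, one_mul, Finset.sum_mul]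
    congr 1
    refine Finset.sum_congr rfl fun k _ => ?_
    rw [rightDefect, div_mul_cancel₀ _ hF0.ne']
  rw [entropyRatio, entropyRatio, ← mul_div_assoc, div_le_div_iff₀ hF0 hK0]
  calc Real.log (trajectory α F X).ncard * K.card
      = K.card * Real.log (trajectory α F X).ncard := mul_comm _ _
    _ ≤ (F * K⁻¹).card * Real.log (trajectory α K X).ncard := h1
    _ ≤ ((1 + ∑ k ∈ K, rightDefect k⁻¹ F) * F.card) * Real.log (trajectory α K X).ncard :=
        mul_le_mul_of_nonneg_right h2 hl
    _ = _ := by ring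

theorem eventually_nonempty_rightFolner (S : Type*) [Semigroup S] :
    ∀ᶠ F in rightFolner S, F.Nonempty :=
  mem_inf_of_left (mem_principal_self _)

theorem tendsto_rightDefect {S : Type*} [Semigroup S] (s : S) :
    Tendsto (rightDefect s) (rightFolner S) (𝓝 0) :=
  tendsto_comap.mono_left (inf_le_right.trans (iInf_le _ s))

/-- The infimum rule: along right Følner sets, the entropy ratios converge to their infimum over
all nonempty finite sets. -/
theorem tendsto_entropyRatio (α : S →* AddMonoid.End A) {X : Set A} (hX : X.Finite)
    (hX' : X.Nonempty) :
    Tendsto (entropyRatio α X) (rightFolner S)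
      (𝓝 (⨅ K : {K : Finset S // K.Nonempty}, entropyRatio α X K.1)) := by
  have hbdd : BddBelow (Set.range fun K : {K : Finset S // K.Nonempty} =>
      entropyRatio α X K.1) := ⟨0, by rintro _ ⟨K, rfl⟩; exact entropyRatio_nonneg α X K.1⟩
  have : Nonempty {K : Finset S // K.Nonempty} := ⟨⟨{1}, Finset.singleton_nonempty 1⟩⟩
  refine tendsto_order.2 ⟨fun b hb => ?_, fun b hb => ?_⟩
  · filter_upwards [eventually_nonempty_rightFolner S] with F hF
    exact hb.trans_le (ciInf_le hbdd ⟨F, hF⟩)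
  · obtain ⟨⟨K, hK⟩, hKb⟩ := exists_lt_of_ciInf_lt hb
    have hlim : Tendsto (fun F => (1 + ∑ k ∈ K, rightDefect k⁻¹ F) * entropyRatio α X K)
        (rightFolner S) (𝓝 ((1 + ∑ k ∈ K, (0 : ℝ)) * entropyRatio α X K)) :=
      ((tendsto_finsetSum K fun k _ => tendsto_rightDefect k⁻¹).const_add 1).mul_const _
    simp only [Finset.sum_const_zero, add_zero, one_mul] at hlim
    filter_upwards [eventually_nonempty_rightFolner S, hlim.eventually_lt_const hKb] with F hF hFb
    exact (entropyRatio_le_mul α hX hX' hF hK).trans_lt hFb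

theorem halgWellDefined_of_neBot (α : S →* AddMonoid.End A) (h : (rightFolner S).NeBot) :
    HalgWellDefined α :=
  ⟨h, fun _ hX hX' => tendsto_nhds_limUnder ⟨_, tendsto_entropyRatio α hX hX'⟩⟩

theorem Halg_le_entropyRatio {α : S →* AddMonoid.End A} (h : HalgWellDefined α) {X : Set A}
    (hX : X.Finite) (hX' : X.Nonempty) {K : Finset S} (hK : K.Nonempty) :
    Halg α X ≤ entropyRatio α X K := by
  have := h.1
  rw [tendsto_nhds_unique (h.2 X hX hX') (tendsto_entropyRatio α hX hX')]
  exact ciInf_le (f := fun K : {K : Finset S // K.Nonempty} => entropyRatio α X K.1)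
    ⟨0, by rintro _ ⟨K, rfl⟩; exact entropyRatio_nonneg α X K.1⟩ ⟨K, hK⟩

theorem entropyRatio_restrict (α : S →* AddMonoid.End A) (N : Subgroup S) (X : Set A)
    (F : Finset N) :
    entropyRatio (restrict α N) X F = entropyRatio α X (F.map ⟨(↑), Subtype.val_injective⟩) := by
  simp [entropyRatio, trajectory, restrict]

/-- Every ratio over a non-empty finite subset of `N` is a ratio over a subset of `G`, hence bounds
the infimum `Halg α X` from above; the bound survives the limit along `N`. -/
theorem Halg_le_Halg_restrict {α : S →* AddMonoid.End A} {N : Subgroup S}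
    (h : HalgWellDefined α) (hN : HalgWellDefined (restrict α N)) {X : Set A}
    (hX : X.Finite) (hX' : X.Nonempty) : Halg α X ≤ Halg (restrict α N) X := by
  have := hN.1
  refine ge_of_tendsto (hN.2 X hX hX') ?_
  filter_upwards [eventually_nonempty_rightFolner N] with F hF
  rw [entropyRatio_restrict]
  exact Halg_le_entropyRatio h hX hX' (hF.map)

end Limit

end AlgEntropy

theorem mainTheorem11 {G A : Type*} [Group G] [AddCommGroup A]
    (hG : AlgEntropy.IsAmenable G) (α : G →* AddMonoid.End A)
    (N : Subgroup G) (hN : N.Normal) :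
    (AlgEntropy.HalgWellDefined α ∧ AlgEntropy.HalgWellDefined (AlgEntropy.restrict α N)) ∧
      AlgEntropy.halg α ≤ AlgEntropy.halg (AlgEntropy.restrict α N) ∧
      AlgEntropy.ent α ≤ AlgEntropy.ent (AlgEntropy.restrict α N) := by
  have hmean := AlgEntropy.IsRightAmenable.hasRightInvariantMean hG.2
  have h1 := AlgEntropy.halgWellDefined_of_neBot α hmean.rightFolner_neBot
  have h2 := AlgEntropy.halgWellDefined_of_neBot (AlgEntropy.restrict α N)
    (hmean.subgroup N).rightFolner_neBot
  refine ⟨⟨h1, h2⟩, iSup_mono fun X => ?_, iSup_mono fun B => ?_⟩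
  · exact EReal.coe_le_coe_iff.2 (AlgEntropy.Halg_le_Halg_restrict h1 h2 X.2.1 X.2.2)
  · exact EReal.coe_le_coe_iff.2 (AlgEntropy.Halg_le_Halg_restrict h1 h2 B.2 ⟨0, B.1.zero_mem⟩)
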